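/- Let $a<b$ be real numbers. \textbf{Definitions.} Let $F\colon[a,b]\to\mathbb R$ be continuous. For $x\in[a,b)$ and $0<\delta\le b-x$ put $$\underline{LD}_1^{+}F(x)=\liminf_{s\to\infty}\, s^{2}\int_0^{\delta}e^{-st}\,[F(x+t)-F(x)]\,dt ,$$ and for $x\in(a,b]$ and $0<\delta\le x-a$ put $$\underline{LD}_1^{-}F(x)=\liminf_{s\to\infty}\,(-s^{2})\int_0^{\delta}e^{-st}\,[F(x-t)-F(x)]\,dt ;$$ these values in $[-\infty,\infty]$ do not depend on $\delta$. The lower Laplace derivate $\underline{LD}_1F(x)$ is the smaller of the two (at the endpoints $a$ and $b$ only the one-sided derivate from inside the interval is used). A continuous $U\colon[a,b]\to\mathbb R$ is a major function of $f\colon[a,b]\to\mathbb R$ if $\underline{LD}_1U\ge f$ and $\underline{LD}_1U>-\infty$ at every point of $[a,b]$; $V$ is a minor function of $f$ if $-V$ is a major function of $-f$. The function $f$ is Laplace integrable on $[a,b]$ if $$\sup\{V(b)-V(a) : V \text{ a minor function of } f\}=\inf\{U(b)-U(a) : U\text{ a major function of } f\}$$ and the common value is finite; this value is the Laplace integral $\int_a^b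 f$ (and $\int_a^a f=0$). A sequence of functions $F_n\colon[a,b]\to\mathbb R$ is equiabsolutely continuous on $[a,b]$ if for every $\varepsilon>0$ there is a $\delta>0$ such that $\sum_i|F_n(v_i)-F_n(u_i)|<\varepsilon$ for all $n$ and all finite families of nonoverlapping intervals $[u_i,v_i]\subseteq[a,b]$ with $\sum_i(v_i-u_i)<\delta$. \textbf{Theorem.} Let $f_n\colon[a,b]\to\mathbb R$ $(n\in\mathbb N)$ and $g\colon[a,b]\to\mathbb R$ be Laplace integrable on $[a,b]$, let $f\colon[a,b]\to\mathbb R$, and suppose that $f_n\ge g$ a.e. on $[a,b]$ for every $n$ and that $\lim_{n\to\infty}f_n=f$ a.e. on $[a,b]$. Then the following hold. (0) All integrals below exist: a function that is Laplace integrable on $[a,b]$ is Laplace integrable on $[a,x]$ for every $x\in[a,b]$, and each $f_n-g$ is Laplace integrable on $[a,b]$. (1) The following two assertions are equivalent: (i) $f$ is Laplace integrable on $[a,b]$ and $\lim_{n\to\infty}\int_a^xf_n=\int_a^xf$ for every $x\in[a,b]$; (ii) the sequence of functions $x\mapsto\int_a^x(f_n-g)$ is equiabsolutely continuous on $[a,b]$.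 (2) (Dominated convergence) If, in addition, there is a Laplace integrable function $h$ on $[a,b]$ such that $f_n\le h$ a.e. on $[a,b]$ for every $n$, then $f$ is Laplace integrable on $[a,b]$ and $\lim_{n\to\infty}\int_a^xf_n=\int_a^xf$ for every $x\in[a,b]$. -/

import Mathlib

open MeasureTheory Filter Topology Set

noncomputable section

/-! ### Laplace derivates -/

/-- The lower right Laplace derivate of `F` at `x`, computed with the window `[x, x + δ]`:
the lower limit, as `s → ∞`, of `s² ∫₀^δ e^{-st} (F (x + t) - F x) dt`. -/
def lowerRightLaplaceDerivate (F : ℝ → ℝ) (x δ : ℝ) : EReal :=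
  liminf (fun s : ℝ =>
    ((s ^ 2 * ∫ t in (0 : ℝ)..δ, Real.exp (-(s * t)) * (F (x + t) - F x) : ℝ) : EReal)) atTop

/-- The lower left Laplace derivate of `F` at `x`, computed with the window `[x - δ, x]`:
the lower limit, as `s → ∞`, of `-s² ∫₀^δ e^{-st} (F (x - t) - F x) dt`. -/
def lowerLeftLaplaceDerivate (F : ℝ → ℝ) (x δ : ℝ) : EReal :=
  liminf (fun s : ℝ =>
    ((-s ^ 2 * ∫ t in (0 : ℝ)..δ, Real.exp (-(s * t)) * (F (x - t) - F x) : ℝ) : EReal)) atTop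

open Classical in
/-- The lower Laplace derivate at `x` of a continuous function `F` on `[a, b]`: the smaller of the
lower right and the lower left derivates, where at an endpoint of `[a, b]` only the side that lies
in `[a, b]` counts. The windows are the largest ones in `[a, b]`; by
`lowerRightLaplaceDerivate_eq` and `lowerLeftLaplaceDerivate_eq` below, any smaller window gives
the same value. -/
def lowerLaplaceDerivate (a b : ℝ) (F : ℝ → ℝ) (x : ℝ) : EReal :=
  min (if x < b then lowerRightLaplaceDerivate F x (b - x) else ⊤)
    (if a < x then lowerLeftLaplaceDerivate F x (x - a) else ⊤)

theorem laplace_tail_tendsto {φ : ℝ → ℝ} {δ₁ δ₂ : ℝ} (h₁ : 0 < δ₁) (h₂ : δ₁ ≤ δ₂)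
    (hφ : IntervalIntegrable φ volume δ₁ δ₂) :
    Tendsto (fun s : ℝ => s ^ 2 * ∫ t in δ₁..δ₂, Real.exp (-(s * t)) * φ t) atTop (𝓝 0) := by
  have hlim : Tendsto (fun s : ℝ => (s ^ 2 * Real.exp (-δ₁ * s)) * ∫ t in δ₁..δ₂, |φ t|)
      atTop (𝓝 0) := by
    have h := tendsto_rpow_mul_exp_neg_mul_atTop_nhds_zero 2 δ₁ h₁
    have h' := h.mul_const (∫ t in δ₁..δ₂, |φ t|)
    rw [zero_mul] at h'
    refine h'.congr fun s => ?_
    norm_num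
  refine squeeze_zero_norm' ?_ hlim
  filter_upwards [eventually_ge_atTop (0 : ℝ)] with s hs
  rw [norm_mul, Real.norm_of_nonneg (sq_nonneg s), mul_assoc]
  refine mul_le_mul_of_nonneg_left ?_ (sq_nonneg s)
  rw [← intervalIntegral.integral_const_mul]
  refine intervalIntegral.norm_integral_le_of_norm_le h₂ ?_ (hφ.abs.const_mul _)
  filter_upwards with t ht
  rw [norm_mul, Real.norm_of_nonneg (Real.exp_pos _).le, Real.norm_eq_abs]
  refine mul_le_mul_of_nonneg_right (Real.exp_le_exp.2 ?_) (abs_nonneg _)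
  nlinarith [ht.1]

theorem laplace_liminf_le_of_tendsto_sub {u v : ℝ → ℝ}
    (h : Tendsto (fun s => v s - u s) atTop (𝓝 0)) :
    liminf (fun s => (u s : EReal)) atTop ≤ liminf (fun s => (v s : EReal)) atTop := by
  have h0 : liminf (fun s => ((v s - u s : ℝ) : EReal)) atTop = 0 := by
    have : Tendsto (fun s => ((v s - u s : ℝ) : EReal)) atTop (𝓝 ((0 : ℝ) : EReal)) :=
      (continuous_coe_real_ereal.tendsto 0).comp h
    simpa using this.liminf_eq
  have h1 := EReal.le_liminf_add (f := atTop) (u := fun s => (u s : EReal))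
    (v := fun s => ((v s - u s : ℝ) : EReal))
  rw [h0, add_zero] at h1
  refine h1.trans (le_of_eq (congrArg (fun w => liminf w atTop) ?_))
  funext s
  simp only [Pi.add_apply]
  rw [← EReal.coe_add]
  congr 1
  ring

theorem laplace_liminf_eq {φ : ℝ → ℝ} {δ₁ δ₂ : ℝ} (h₁ : 0 < δ₁) (h₂ : δ₁ ≤ δ₂)
    (hφ : ContinuousOn φ (Icc 0 δ₂)) :
    liminf (fun s : ℝ => ((s ^ 2 * ∫ t in (0 : ℝ)..δ₁, Real.exp (-(s * t)) * φ t : ℝ) : EReal))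
      atTop =
    liminf (fun s : ℝ => ((s ^ 2 * ∫ t in (0 : ℝ)..δ₂, Real.exp (-(s * t)) * φ t : ℝ) : EReal))
      atTop := by
  have key : Tendsto (fun s : ℝ => s ^ 2 * (∫ t in (0 : ℝ)..δ₂, Real.exp (-(s * t)) * φ t)
      - s ^ 2 * ∫ t in (0 : ℝ)..δ₁, Real.exp (-(s * t)) * φ t) atTop (𝓝 0) := by
    have hc : IntervalIntegrable φ volume δ₁ δ₂ :=
      (hφ.mono (Icc_subset_Icc_left h₁.le)).intervalIntegrable_of_Icc h₂
    refine (laplace_tail_tendsto h₁ h₂ hc).congr fun s => ?_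
    have hs : ContinuousOn (fun t => Real.exp (-(s * t)) * φ t) (Icc 0 δ₂) :=
      ContinuousOn.mul (by fun_prop) hφ
    rw [← mul_sub, intervalIntegral.integral_interval_sub_left
      (hs.intervalIntegrable_of_Icc (h₁.le.trans h₂))
      ((hs.mono (Icc_subset_Icc_right h₂)).intervalIntegrable_of_Icc h₁.le)]
  refine le_antisymm (laplace_liminf_le_of_tendsto_sub key)
    (laplace_liminf_le_of_tendsto_sub ?_)
  simpa using key.neg

/-- For continuous `F`, the lower right Laplace derivate does not depend on the window. -/
theorem lowerRightLaplaceDerivate_eq {F : ℝ → ℝ} {x b δ : ℝ} (hδ : 0 < δ) (hb : δ ≤ b - x)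
    (hF : ContinuousOn F (Icc x b)) :
    lowerRightLaplaceDerivate F x δ = lowerRightLaplaceDerivate F x (b - x) := by
  refine laplace_liminf_eq (φ := fun t => F (x + t) - F x) hδ hb ?_
  refine ContinuousOn.sub (hF.comp (by fun_prop) fun t ht => ?_) continuousOn_const
  constructor <;> linarith [ht.1, ht.2]

/-- For continuous `F`, the lower left Laplace derivate does not depend on the window. -/
theorem lowerLeftLaplaceDerivate_eq {F : ℝ → ℝ} {x a δ : ℝ} (hδ : 0 < δ) (ha : δ ≤ x - a)
    (hF : ContinuousOn F (Icc a x)) :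
    lowerLeftLaplaceDerivate F x δ = lowerLeftLaplaceDerivate F x (x - a) := by
  have h := laplace_liminf_eq (φ := fun t => -(F (x - t) - F x)) hδ ha (by
    refine (ContinuousOn.sub (hF.comp (by fun_prop) fun t ht => ?_) continuousOn_const).neg
    constructor <;> linarith [ht.1, ht.2])
  simpa only [mul_neg, intervalIntegral.integral_neg, lowerLeftLaplaceDerivate, neg_mul] using h

/-! ### The Laplace integral

A function on `[a, b]` is given by a function `ℝ → ℝ`, of which only the values on `[a, b]` are
used. -/

/-- `U` is a major function of `f` on `[a, b]`. -/
structure IsLaplaceMajor (f : ℝ → ℝ) (a b : ℝ) (U : ℝ → ℝ) : Prop where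
  continuousOn : ContinuousOn U (Icc a b)
  le_derivate : ∀ x ∈ Icc a b, (f x : EReal) ≤ lowerLaplaceDerivate a b U x
  bot_lt_derivate : ∀ x ∈ Icc a b, ⊥ < lowerLaplaceDerivate a b U x

/-- `V` is a minor function of `f` on `[a, b]`: `-V` is a major function of `-f`, that is, the
upper Laplace derivate of `V` is at most `f` and less than `∞`. -/
def IsLaplaceMinor (f : ℝ → ℝ) (a b : ℝ) (V : ℝ → ℝ) : Prop :=
  IsLaplaceMajor (fun x => -f x) a b (fun x => -V x)

/-- The infimum of the increments `U b - U a` of the major functions `U` of `f` on `[a, b]`. -/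
def upperLaplaceIntegral (f : ℝ → ℝ) (a b : ℝ) : EReal :=
  ⨅ (U : ℝ → ℝ) (_ : IsLaplaceMajor f a b U), ((U b - U a : ℝ) : EReal)

/-- The supremum of the increments `V b - V a` of the minor functions `V` of `f` on `[a, b]`. -/
def lowerLaplaceIntegral (f : ℝ → ℝ) (a b : ℝ) : EReal :=
  ⨆ (V : ℝ → ℝ) (_ : IsLaplaceMinor f a b V), ((V b - V a : ℝ) : EReal)

/-- `f` is Laplace integrable on `[a, b]`: its lower and upper integrals are equal and finite. -/
def LaplaceIntegrable (f : ℝ → ℝ) (a b : ℝ) : Prop :=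
  ∃ I : ℝ, lowerLaplaceIntegral f a b = I ∧ upperLaplaceIntegral f a b = I

/-- The Laplace integral of `f` on `[a, b]`, meaningful if `f` is Laplace integrable there. -/
def laplaceIntegral (f : ℝ → ℝ) (a b : ℝ) : ℝ :=
  (upperLaplaceIntegral f a b).toReal

/-! ### Equiabsolute continuity -/

/-- The functions `F n` are equiabsolutely continuous on `[a, b]`: for every `ε > 0` there is a
`δ > 0`, the same for all `n`, such that `∑ |F n (v i) - F n (u i)| < ε` for every finite family of
nonoverlapping intervals `[u i, v i] ⊆ [a, b]` of total length less than `δ`. -/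
def EquiAbsolutelyContinuousOn (F : ℕ → ℝ → ℝ) (a b : ℝ) : Prop :=
  ∀ ε : ℝ, 0 < ε → ∃ δ : ℝ, 0 < δ ∧ ∀ (n k : ℕ) (u v : Fin k → ℝ),
    (∀ i, a ≤ u i ∧ u i ≤ v i ∧ v i ≤ b) →
    (∀ i j, i ≠ j → Disjoint (Ioo (u i) (v i)) (Ioo (u j) (v j))) →
    ∑ i, (v i - u i) < δ →
    ∑ i, |F n (v i) - F n (u i)| < ε

end

/-! The Laplace integral is of Perron type: it integrates more functions than Lebesgue's, but no
more nonnegative ones. Since `f_n - g ≥ 0` a.e., the theorem reduces to Lebesgue theory for `u_n =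
f_n - g` and `w = f - g`; adding `g` back is linearity.

The comparison principle behind the integral is that a continuous function with nonnegative lower
Laplace derivate is nondecreasing (`monotoneOn_of_lowerLaplaceDerivate_nonneg`). Hence `U - V` is
nondecreasing for every major `U` and minor `V`. If `f ≥ 0`, every major function is itself
nondecreasing, so it is differentiable a.e. with integrable derivative; derivatives of good major
functions converge a.e. to `f` and dominate it, so `f` is Lebesgue integrable. Conversely,
Vitali–Carathéodory turns Lebesgue integrable functions into Laplace integrable ones with the same
integral.

For (i) ⇒ (ii), Scheffé's lemma gives `u_n → w` in L¹, hence uniform integrability, hence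
equiabsolute continuity. For (ii) ⇒ (i), nonnegativity upgrades equiabsolute continuity from finite
unions of intervals to all measurable sets, and Vitali's theorem applies. Part (2) is Lebesgue's
dominated convergence with bound `h - g`. -/

/-! ### Laplace means -/

/-- The lower limit, as `s → ∞`, of `s² ∫₀^δ e^{-st} φ t dt`. -/
noncomputable def lowerLaplaceMean (φ : ℝ → ℝ) (δ : ℝ) : EReal :=
  liminf (fun s : ℝ => ((s ^ 2 * ∫ t in (0 : ℝ)..δ, Real.exp (-(s * t)) * φ t : ℝ) : EReal)) atTop

theorem lowerRightLaplaceDerivate_eq_mean (F : ℝ → ℝ) (x δ : ℝ) :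
    lowerRightLaplaceDerivate F x δ = lowerLaplaceMean (fun t => F (x + t) - F x) δ := rfl

theorem lowerLeftLaplaceDerivate_eq_mean (F : ℝ → ℝ) (x δ : ℝ) :
    lowerLeftLaplaceDerivate F x δ = lowerLaplaceMean (fun t => F x - F (x - t)) δ := by
  unfold lowerLeftLaplaceDerivate lowerLaplaceMean
  refine congrArg (fun w => liminf w atTop) (funext fun s => ?_)
  rw [neg_mul, ← mul_neg, ← intervalIntegral.integral_neg]
  simp only [← mul_neg, neg_sub]

theorem intervalIntegrable_exp_mul {φ : ℝ → ℝ} {δ : ℝ} (hδ : 0 ≤ δ)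
    (hφ : ContinuousOn φ (Icc 0 δ)) (s : ℝ) :
    IntervalIntegrable (fun t => Real.exp (-(s * t)) * φ t) volume 0 δ :=
  (ContinuousOn.mul (by fun_prop) hφ).intervalIntegrable_of_Icc hδ

/-- Superadditivity of the lower limit. No side condition is needed because `⊥ + ⊤ = ⊥` in `EReal`.
-/
theorem lowerLaplaceMean_add_le {φ ψ : ℝ → ℝ} {δ : ℝ} (hδ : 0 ≤ δ)
    (hφ : ContinuousOn φ (Icc 0 δ)) (hψ : ContinuousOn ψ (Icc 0 δ)) :
    lowerLaplaceMean φ δ + lowerLaplaceMean ψ δ ≤ lowerLaplaceMean (fun t => φ t + ψ t) δ := by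
  refine EReal.le_liminf_add.trans (le_of_eq (congrArg (fun w => liminf w atTop) ?_))
  funext s
  simp only [Pi.add_apply]
  rw [← EReal.coe_add, ← mul_add, ← intervalIntegral.integral_add
    (intervalIntegrable_exp_mul hδ hφ s) (intervalIntegrable_exp_mul hδ hψ s)]
  simp only [mul_add]

theorem lowerLaplaceMean_mono {φ ψ : ℝ → ℝ} {δ : ℝ} (hδ : 0 ≤ δ)
    (hφ : ContinuousOn φ (Icc 0 δ)) (hψ : ContinuousOn ψ (Icc 0 δ))
    (h : ∀ t ∈ Icc 0 δ, φ t ≤ ψ t) : lowerLaplaceMean φ δ ≤ lowerLaplaceMean ψ δ := by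
  refine liminf_le_liminf (Eventually.of_forall fun s => EReal.coe_le_coe_iff.2 ?_)
  refine mul_le_mul_of_nonneg_left (intervalIntegral.integral_mono_on hδ
    (intervalIntegrable_exp_mul hδ hφ s) (intervalIntegrable_exp_mul hδ hψ s) fun t ht => ?_)
    (sq_nonneg s)
  exact mul_le_mul_of_nonneg_left (h t ht) (Real.exp_pos _).le

/-- The factor `s²` is the right normalization because `∫₀^∞ e^{-st} t dt = 1/s²`. Comparison with
linear functions then turns bounds on difference quotients into bounds on derivates. -/
theorem lowerLaplaceMean_const_mul {δ : ℝ} (hδ : 0 < δ) (c : ℝ) :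
    lowerLaplaceMean (fun t => c * t) δ = c := by
  have hint : ∀ s : ℝ, 0 < s →
      s ^ 2 * ∫ t in (0 : ℝ)..δ, Real.exp (-(s * t)) * (c * t)
        = c * (1 - (δ * s + 1) * Real.exp (-(δ * s))) := by
    intro s hs
    have hd : ∀ t ∈ uIcc 0 δ, HasDerivAt
        (fun t => -(c * (s * t + 1) * Real.exp (-(s * t))) / s ^ 2)
        (Real.exp (-(s * t)) * (c * t)) t := by
      intro t _
      have h1 : HasDerivAt (fun t => s * t) s t := by simpa using (hasDerivAt_id t).const_mul s
      have h2 := (((h1.add_const 1).const_mul c).mul h1.neg.exp).neg.div_const (s ^ 2)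
      refine h2.congr_deriv ?_
      simp only [Pi.neg_apply]
      field_simp
      ring
    rw [intervalIntegral.integral_eq_sub_of_hasDerivAt hd
      ((by fun_prop : Continuous fun t => Real.exp (-(s * t)) * (c * t)).intervalIntegrable _ _)]
    simp only [mul_zero, neg_zero, Real.exp_zero]
    rw [mul_comm s δ]
    field_simp
    ring
  have hlim : Tendsto (fun s : ℝ => c * (1 - (δ * s + 1) * Real.exp (-(δ * s)))) atTop (𝓝 c) := by
    have h0 : Tendsto (fun y : ℝ => (y + 1) * Real.exp (-y)) atTop (𝓝 0) := by
      have h1 := Real.tendsto_pow_mul_exp_neg_atTop_nhds_zero 1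
      have h2 := Real.tendsto_pow_mul_exp_neg_atTop_nhds_zero 0
      have h3 := h1.add h2
      simp only [pow_one, pow_zero, add_zero, ← add_mul] at h3
      exact h3
    have h1 := h0.comp (tendsto_id.const_mul_atTop hδ)
    simpa using (h1.const_sub 1).const_mul c
  refine Tendsto.liminf_eq ((continuous_coe_real_ereal.tendsto c).comp (hlim.congr' ?_))
  filter_upwards [eventually_gt_atTop 0] with s hs using (hint s hs).symm

theorem le_lowerLaplaceMean {φ : ℝ → ℝ} {δ η c : ℝ} (hη : 0 < η) (hηδ : η ≤ δ)
    (hφ : ContinuousOn φ (Icc 0 δ)) (h : ∀ t ∈ Icc 0 η, c * t ≤ φ t) :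
    (c : EReal) ≤ lowerLaplaceMean φ δ := by
  rw [← lowerLaplaceMean_const_mul hη c]
  refine (lowerLaplaceMean_mono hη.le (by fun_prop) (hφ.mono (Icc_subset_Icc_right hηδ)) h).trans
    (laplace_liminf_eq hη hηδ hφ).le

theorem lowerLaplaceMean_le {φ : ℝ → ℝ} {δ η c : ℝ} (hη : 0 < η) (hηδ : η ≤ δ)
    (hφ : ContinuousOn φ (Icc 0 δ)) (h : ∀ t ∈ Icc 0 η, φ t ≤ c * t) :
    lowerLaplaceMean φ δ ≤ c := by
  rw [← lowerLaplaceMean_const_mul hη c]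
  refine (laplace_liminf_eq hη hηδ hφ).ge.trans
    (lowerLaplaceMean_mono hη.le (hφ.mono (Icc_subset_Icc_right hηδ)) (by fun_prop) h)

/-! ### Laplace derivates of continuous functions -/

theorem ContinuousOn.right_increment {F : ℝ → ℝ} {a b x : ℝ} (hF : ContinuousOn F (Icc a b))
    (hx : x ∈ Icc a b) : ContinuousOn (fun t => F (x + t) - F x) (Icc 0 (b - x)) := by
  refine ContinuousOn.sub (hF.comp (by fun_prop) fun t ht => ?_) continuousOn_const
  constructor <;> linarith [ht.1, ht.2, hx.1]

theorem ContinuousOn.left_increment {F : ℝ → ℝ} {a b x : ℝ} (hF : ContinuousOn F (Icc a b))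
    (hx : x ∈ Icc a b) : ContinuousOn (fun t => F x - F (x - t)) (Icc 0 (x - a)) := by
  refine continuousOn_const.sub (hF.comp (by fun_prop) fun t ht => ?_)
  constructor <;> linarith [ht.1, ht.2, hx.2]

theorem lowerLaplaceDerivate_add_le {F G : ℝ → ℝ} {a b x : ℝ} (hF : ContinuousOn F (Icc a b))
    (hG : ContinuousOn G (Icc a b)) (hx : x ∈ Icc a b) :
    lowerLaplaceDerivate a b F x + lowerLaplaceDerivate a b G x
      ≤ lowerLaplaceDerivate a b (fun y => F y + G y) x := by
  unfold lowerLaplaceDerivate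
  refine le_min ((add_le_add (min_le_left _ _) (min_le_left _ _)).trans ?_)
    ((add_le_add (min_le_right _ _) (min_le_right _ _)).trans ?_)
  · split_ifs with h
    · simp only [lowerRightLaplaceDerivate_eq_mean]
      refine (lowerLaplaceMean_add_le (by linarith) (hF.right_increment hx)
        (hG.right_increment hx)).trans (le_of_eq ?_)
      congr 1
      funext t
      ring
    · exact le_top
  · split_ifs with h
    · simp only [lowerLeftLaplaceDerivate_eq_mean]
      refine (lowerLaplaceMean_add_le (by linarith) (hF.left_increment hx)
        (hG.left_increment hx)).trans (le_of_eq ?_)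
      congr 1
      funext t
      ring
    · exact le_top

/-- A local lower bound for the difference quotients bounds the lower Laplace derivate. -/
theorem le_lowerLaplaceDerivate {F : ℝ → ℝ} {a b x c : ℝ} (hF : ContinuousOn F (Icc a b))
    (hx : x ∈ Icc a b) {η : ℝ} (hη : 0 < η)
    (h : ∀ u ∈ Icc a b, ∀ v ∈ Icc a b, u ≤ v → x - η ≤ u → v ≤ x + η →
      c * (v - u) ≤ F v - F u) :
    (c : EReal) ≤ lowerLaplaceDerivate a b F x := by
  unfold lowerLaplaceDerivate
  refine le_min ?_ ?_
  · split_ifs with hb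
    · rw [lowerRightLaplaceDerivate_eq_mean]
      refine le_lowerLaplaceMean (lt_min hη (sub_pos.2 hb)) (min_le_right _ _)
        (hF.right_increment hx) fun t ht => ?_
      have h1 := ht.2.trans (min_le_left _ _)
      have h2 := ht.2.trans (min_le_right _ _)
      have := h x hx (x + t) ⟨by linarith [hx.1, ht.1], by linarith⟩ (by linarith [ht.1])
        (by linarith) (by linarith)
      simpa using this
    · exact le_top
  · split_ifs with ha
    · rw [lowerLeftLaplaceDerivate_eq_mean]
      refine le_lowerLaplaceMean (lt_min hη (sub_pos.2 ha)) (min_le_right _ _)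
        (hF.left_increment hx) fun t ht => ?_
      have h1 := ht.2.trans (min_le_left _ _)
      have h2 := ht.2.trans (min_le_right _ _)
      have := h (x - t) ⟨by linarith, by linarith [hx.2, ht.1]⟩ x hx (by linarith [ht.1])
        (by linarith) (by linarith)
      simpa using this
    · exact le_top

/-- A local upper bound for the right difference quotients bounds the lower Laplace derivate. -/
theorem lowerLaplaceDerivate_le {F : ℝ → ℝ} {a b x c : ℝ} (hF : ContinuousOn F (Icc a b))
    (hx : x ∈ Ico a b) {η : ℝ} (hη : 0 < η) (hηb : x + η ≤ b)
    (h : ∀ t ∈ Icc 0 η, F (x + t) - F x ≤ c * t) :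
    lowerLaplaceDerivate a b F x ≤ c := by
  unfold lowerLaplaceDerivate
  rw [if_pos hx.2, lowerRightLaplaceDerivate_eq_mean]
  exact (min_le_left _ _).trans
    (lowerLaplaceMean_le hη (by linarith) (hF.right_increment (Ico_subset_Icc_self hx)) h)

/-- The lower derivate is a minimum over the two sides, so an upper bound needs only the right
difference quotients, which lie below any `c > d` near `x`. -/
theorem lowerLaplaceDerivate_le_of_hasDerivAt {F : ℝ → ℝ} {a b x d : ℝ}
    (hF : ContinuousOn F (Icc a b)) (hx : x ∈ Ioo a b) (h : HasDerivAt F d x) :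
    lowerLaplaceDerivate a b F x ≤ d := by
  refine EReal.le_of_forall_lt_iff_le.1 fun c hc => ?_
  have hc' : d < c := EReal.coe_lt_coe_iff.1 hc
  have h1 := (hasDerivAt_iff_tendsto_slope_zero.1 h).eventually (gt_mem_nhds hc')
  rw [eventually_nhdsWithin_iff] at h1
  obtain ⟨η, hη, hball⟩ := Metric.eventually_nhds_iff.1 h1
  have hb : 0 < b - x := sub_pos.2 hx.2
  refine lowerLaplaceDerivate_le hF ⟨hx.1.le, hx.2⟩ (η := min (η / 2) (b - x))
    (lt_min (by linarith) hb) (by linarith [min_le_right (η / 2) (b - x)]) fun t ht => ?_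
  rcases ht.1.eq_or_lt with h0 | h0
  · simp [← h0]
  · have h2 := ht.2.trans (min_le_left _ _)
    have := hball (y := t) (by rw [Real.dist_eq, sub_zero, abs_of_pos h0]; linarith) h0.ne'
    rw [smul_eq_mul, inv_mul_lt_iff₀ h0] at this
    linarith

/-- A continuous function whose lower Laplace derivate is nonnegative is nondecreasing. -/
theorem monotoneOn_of_lowerLaplaceDerivate_nonneg {U : ℝ → ℝ} {a b : ℝ}
    (hU : ContinuousOn U (Icc a b)) (h : ∀ x ∈ Icc a b, 0 ≤ lowerLaplaceDerivate a b U x) :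
    MonotoneOn U (Icc a b) := by
  intro c hc d hd hcd
  rcases hcd.eq_or_lt with rfl | hlt
  · exact le_rfl
  by_contra! hdc
  -- The slope `ε` is so small that the tilted function `U y + ε y` is still larger at `c` than at
  -- `d`; its maximum on `[c, d]` is therefore not at `d`.
  obtain ⟨ε, hε, hεU⟩ : ∃ ε : ℝ, 0 < ε ∧ ε * (d - c) < U c - U d := by
    refine ⟨(U c - U d) / (2 * (d - c)), by apply div_pos <;> linarith, ?_⟩
    have : d - c ≠ 0 := by linarith
    field_simp
    linarith
  have hW : ContinuousOn (fun y => U y + ε * y) (Icc a b) := hU.add (by fun_prop)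
  have hsub : Icc c d ⊆ Icc a b := Icc_subset_Icc hc.1 hd.2
  obtain ⟨x, hx, hmax⟩ := isCompact_Icc.exists_isMaxOn (nonempty_Icc.2 hcd) (hW.mono hsub)
  have hmax' : ∀ y ∈ Icc c d, U y + ε * y ≤ U x + ε * x := fun y hy => hmax hy
  have hxd : x < d := by
    refine lt_of_le_of_ne hx.2 fun hxd => ?_
    have := hmax' c (left_mem_Icc.2 hcd)
    rw [hxd] at this
    nlinarith
  -- To the right of a maximum the increments are nonpositive, so the derivate is at most `0`;
  -- superadditivity makes it at least `ε`.
  have h1 : lowerLaplaceDerivate a b (fun y => U y + ε * y) x ≤ (0 : ℝ) := by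
    refine lowerLaplaceDerivate_le hW ⟨(hsub hx).1, hxd.trans_le hd.2⟩ (sub_pos.2 hxd)
      (by linarith [hd.2]) fun t ht => ?_
    have := hmax' (x + t) ⟨by linarith [hx.1, ht.1], by linarith [ht.2]⟩
    linarith
  have h2 : (ε : EReal) ≤ lowerLaplaceDerivate a b (fun y => ε * y) x :=
    le_lowerLaplaceDerivate (by fun_prop) (hsub hx) one_pos fun u _ v _ _ _ _ => by linarith
  have h3 := (add_le_add (h x (hsub hx)) h2).trans
    ((lowerLaplaceDerivate_add_le hU (by fun_prop) (hsub hx)).trans h1)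
  rw [zero_add, EReal.coe_le_coe_iff] at h3
  linarith

/-! ### Algebra of the Laplace integral -/

theorem EReal.bot_lt_add_of_bot_lt {x y : EReal} (hx : ⊥ < x) (hy : ⊥ < y) : ⊥ < x + y :=
  bot_lt_iff_ne_bot.2 fun h => (EReal.add_eq_bot_iff.1 h).elim hx.ne' hy.ne'

theorem IsLaplaceMajor.add {f g U W : ℝ → ℝ} {a b : ℝ} (hU : IsLaplaceMajor f a b U)
    (hW : IsLaplaceMajor g a b W) :
    IsLaplaceMajor (fun x => f x + g x) a b (fun x => U x + W x) where
  continuousOn := hU.continuousOn.add hW.continuousOn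
  le_derivate x hx := by
    rw [EReal.coe_add]
    exact (add_le_add (hU.le_derivate x hx) (hW.le_derivate x hx)).trans
      (lowerLaplaceDerivate_add_le hU.continuousOn hW.continuousOn hx)
  bot_lt_derivate x hx :=
    (EReal.bot_lt_add_of_bot_lt (hU.bot_lt_derivate x hx) (hW.bot_lt_derivate x hx)).trans_le
      (lowerLaplaceDerivate_add_le hU.continuousOn hW.continuousOn hx)

theorem IsLaplaceMinor.add {f g V W : ℝ → ℝ} {a b : ℝ} (hV : IsLaplaceMinor f a b V)
    (hW : IsLaplaceMinor g a b W) :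
    IsLaplaceMinor (fun x => f x + g x) a b (fun x => V x + W x) := by
  have := IsLaplaceMajor.add hV hW
  simp only [← neg_add] at this
  exact this

theorem isLaplaceMinor_neg_iff {f U : ℝ → ℝ} {a b : ℝ} :
    IsLaplaceMinor (fun x => -f x) a b (fun x => -U x) ↔ IsLaplaceMajor f a b U := by
  simp [IsLaplaceMinor]

/-- A major function of a nonnegative function is nondecreasing. -/
theorem IsLaplaceMajor.monotoneOn {f U : ℝ → ℝ} {a b : ℝ} (hU : IsLaplaceMajor f a b U)
    (hf : ∀ x ∈ Icc a b, 0 ≤ f x) : MonotoneOn U (Icc a b) :=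
  monotoneOn_of_lowerLaplaceDerivate_nonneg hU.continuousOn fun x hx =>
    (EReal.coe_nonneg.2 (hf x hx)).trans (hU.le_derivate x hx)

/-- `U + (-V)` is a major function of `f + (-f) = 0`. -/
theorem IsLaplaceMajor.monotoneOn_sub {f U V : ℝ → ℝ} {a b : ℝ} (hU : IsLaplaceMajor f a b U)
    (hV : IsLaplaceMinor f a b V) : MonotoneOn (fun x => U x - V x) (Icc a b) := by
  have := (IsLaplaceMajor.add hU hV).monotoneOn (by simp)
  simpa only [← sub_eq_add_neg] using this

/-- Left derivates do not see the right endpoint, right derivates do not depend on the window, and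
at `x` itself the right-hand condition disappears. -/
theorem IsLaplaceMajor.restrict {f U : ℝ → ℝ} {a b x : ℝ} (hU : IsLaplaceMajor f a b U)
    (hx : x ∈ Icc a b) : IsLaplaceMajor f a x U := by
  have hle : ∀ y ∈ Icc a x, lowerLaplaceDerivate a b U y ≤ lowerLaplaceDerivate a x U y := by
    intro y hy
    refine min_le_min ?_ le_rfl
    split_ifs with h1 h2 h2
    · rw [← lowerRightLaplaceDerivate_eq (sub_pos.2 h2) (sub_le_sub_right hx.2 y)
        (hU.continuousOn.mono (Icc_subset_Icc_left hy.1))]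
    · exact le_top
    · exact absurd (h2.trans_le hx.2) h1
    · exact le_rfl
  have hsub : Icc a x ⊆ Icc a b := Icc_subset_Icc_right hx.2
  exact ⟨hU.continuousOn.mono hsub, fun y hy => (hU.le_derivate y (hsub hy)).trans (hle y hy),
    fun y hy => (hU.bot_lt_derivate y (hsub hy)).trans_le (hle y hy)⟩

theorem IsLaplaceMinor.restrict {f V : ℝ → ℝ} {a b x : ℝ} (hV : IsLaplaceMinor f a b V)
    (hx : x ∈ Icc a b) : IsLaplaceMinor f a x V :=
  IsLaplaceMajor.restrict hV hx

theorem lowerLaplaceIntegral_le_upper {f : ℝ → ℝ} {a b : ℝ} (hab : a ≤ b) :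
    lowerLaplaceIntegral f a b ≤ upperLaplaceIntegral f a b := by
  refine iSup₂_le fun V hV => le_iInf₂ fun U hU => EReal.coe_le_coe_iff.2 ?_
  have := hU.monotoneOn_sub hV (left_mem_Icc.2 hab) (right_mem_Icc.2 hab) hab
  linarith

/-- `f` is Laplace integrable on `[a, b]` with integral `I`. -/
def HasLaplaceIntegral (f : ℝ → ℝ) (a b I : ℝ) : Prop :=
  lowerLaplaceIntegral f a b = I ∧ upperLaplaceIntegral f a b = I

theorem HasLaplaceIntegral.integrable {f : ℝ → ℝ} {a b I : ℝ} (h : HasLaplaceIntegral f a b I) :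
    LaplaceIntegrable f a b := ⟨I, h⟩

theorem HasLaplaceIntegral.integral_eq {f : ℝ → ℝ} {a b I : ℝ}
    (h : HasLaplaceIntegral f a b I) : laplaceIntegral f a b = I := by
  rw [laplaceIntegral, h.2, EReal.toReal_coe]

theorem LaplaceIntegrable.hasIntegral {f : ℝ → ℝ} {a b : ℝ} (h : LaplaceIntegrable f a b) :
    HasLaplaceIntegral f a b (laplaceIntegral f a b) := by
  obtain ⟨I, hI⟩ := h
  rwa [HasLaplaceIntegral.integral_eq hI]

theorem HasLaplaceIntegral.exists_major {f : ℝ → ℝ} {a b I ε : ℝ}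
    (h : HasLaplaceIntegral f a b I) (hε : 0 < ε) :
    ∃ U, IsLaplaceMajor f a b U ∧ U b - U a < I + ε := by
  have : upperLaplaceIntegral f a b < ((I + ε : ℝ) : EReal) := by
    rw [h.2, EReal.coe_lt_coe_iff]
    linarith
  simp only [upperLaplaceIntegral, iInf_lt_iff, EReal.coe_lt_coe_iff] at this
  obtain ⟨U, hU, hlt⟩ := this
  exact ⟨U, hU, hlt⟩

theorem HasLaplaceIntegral.exists_minor {f : ℝ → ℝ} {a b I ε : ℝ}
    (h : HasLaplaceIntegral f a b I) (hε : 0 < ε) :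
    ∃ V, IsLaplaceMinor f a b V ∧ I - ε < V b - V a := by
  have : ((I - ε : ℝ) : EReal) < lowerLaplaceIntegral f a b := by
    rw [h.1, EReal.coe_lt_coe_iff]
    linarith
  simp only [lowerLaplaceIntegral, lt_iSup_iff, EReal.coe_lt_coe_iff] at this
  obtain ⟨V, hV, hlt⟩ := this
  exact ⟨V, hV, hlt⟩

theorem hasLaplaceIntegral_of_forall {f : ℝ → ℝ} {a b I : ℝ} (hab : a ≤ b)
    (hU : ∀ ε : ℝ, 0 < ε → ∃ U, IsLaplaceMajor f a b U ∧ U b - U a ≤ I + ε)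
    (hV : ∀ ε : ℝ, 0 < ε → ∃ V, IsLaplaceMinor f a b V ∧ I - ε ≤ V b - V a) :
    HasLaplaceIntegral f a b I := by
  have h1 : upperLaplaceIntegral f a b ≤ I := by
    refine EReal.le_of_forall_lt_iff_le.1 fun c hc => ?_
    obtain ⟨U, hU, hle⟩ := hU (c - I) (sub_pos.2 (EReal.coe_lt_coe_iff.1 hc))
    exact (iInf₂_le U hU).trans (EReal.coe_le_coe_iff.2 (by linarith))
  have h2 : (I : EReal) ≤ lowerLaplaceIntegral f a b := by
    refine EReal.ge_of_forall_gt_iff_ge.1 fun c hc => ?_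
    obtain ⟨V, hV, hle⟩ := hV (I - c) (sub_pos.2 (EReal.coe_lt_coe_iff.1 hc))
    exact le_trans (EReal.coe_le_coe_iff.2 (by linarith))
      (le_iSup₂ (f := fun (V : ℝ → ℝ) (_ : IsLaplaceMinor f a b V) =>
        ((V b - V a : ℝ) : EReal)) V hV)
  have h3 := lowerLaplaceIntegral_le_upper (f := f) hab
  exact ⟨le_antisymm (h3.trans h1) h2, le_antisymm h1 (h2.trans h3)⟩

theorem HasLaplaceIntegral.add {f g : ℝ → ℝ} {a b I J : ℝ} (hab : a ≤ b)
    (hf : HasLaplaceIntegral f a b I) (hg : HasLaplaceIntegral g a b J) :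
    HasLaplaceIntegral (fun x => f x + g x) a b (I + J) := by
  refine hasLaplaceIntegral_of_forall hab (fun ε hε => ?_) (fun ε hε => ?_)
  · obtain ⟨U, hU, hU'⟩ := hf.exists_major (half_pos hε)
    obtain ⟨W, hW, hW'⟩ := hg.exists_major (half_pos hε)
    exact ⟨_, hU.add hW, by linarith⟩
  · obtain ⟨U, hU, hU'⟩ := hf.exists_minor (half_pos hε)
    obtain ⟨W, hW, hW'⟩ := hg.exists_minor (half_pos hε)
    exact ⟨_, hU.add hW, by linarith⟩

theorem HasLaplaceIntegral.neg {f : ℝ → ℝ} {a b I : ℝ} (hab : a ≤ b)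
    (hf : HasLaplaceIntegral f a b I) : HasLaplaceIntegral (fun x => -f x) a b (-I) := by
  refine hasLaplaceIntegral_of_forall hab (fun ε hε => ?_) (fun ε hε => ?_)
  · obtain ⟨V, hV, hV'⟩ := hf.exists_minor hε
    exact ⟨_, hV, by linarith⟩
  · obtain ⟨U, hU, hU'⟩ := hf.exists_major hε
    exact ⟨_, isLaplaceMinor_neg_iff.2 hU, by linarith⟩

theorem HasLaplaceIntegral.sub {f g : ℝ → ℝ} {a b I J : ℝ} (hab : a ≤ b)
    (hf : HasLaplaceIntegral f a b I) (hg : HasLaplaceIntegral g a b J) :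
    HasLaplaceIntegral (fun x => f x - g x) a b (I - J) := by
  simpa only [← sub_eq_add_neg] using hf.add hab (hg.neg hab)

/-- As `U - V` is nondecreasing, its increment over `[a, x]` is at most its increment over `[a, b]`,
which can be made arbitrarily small. -/
theorem LaplaceIntegrable.restrict {f : ℝ → ℝ} {a b x : ℝ} (hf : LaplaceIntegrable f a b)
    (hx : x ∈ Icc a b) : LaplaceIntegrable f a x := by
  have hI := hf.hasIntegral
  have hle := lowerLaplaceIntegral_le_upper (f := f) hx.1
  have key : ∀ ε : ℝ, 0 < ε → ∃ U V, IsLaplaceMajor f a x U ∧ IsLaplaceMinor f a x V ∧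
      U x - U a < V x - V a + ε := by
    intro ε hε
    obtain ⟨U, hU, hU'⟩ := hI.exists_major (half_pos hε)
    obtain ⟨V, hV, hV'⟩ := hI.exists_minor (half_pos hε)
    have := hU.monotoneOn_sub hV hx (right_mem_Icc.2 (hx.1.trans hx.2)) hx.2
    exact ⟨U, V, hU.restrict hx, hV.restrict hx, by linarith⟩
  have hup : ∀ U, IsLaplaceMajor f a x U →
      upperLaplaceIntegral f a x ≤ ((U x - U a : ℝ) : EReal) := fun U hU => iInf₂_le U hU
  have hlow : ∀ V, IsLaplaceMinor f a x V →
      ((V x - V a : ℝ) : EReal) ≤ lowerLaplaceIntegral f a x := fun V hV =>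
    le_iSup₂ (f := fun (V : ℝ → ℝ) (_ : IsLaplaceMinor f a x V) => ((V x - V a : ℝ) : EReal)) V hV
  -- A single pair of a major and a minor function makes the upper integral finite.
  obtain ⟨U₀, V₀, hU₀, hV₀, -⟩ := key 1 one_pos
  have htop : upperLaplaceIntegral f a x ≠ ⊤ :=
    ((hup U₀ hU₀).trans_lt (EReal.coe_lt_top _)).ne
  have hbot : upperLaplaceIntegral f a x ≠ ⊥ :=
    ((EReal.bot_lt_coe _).trans_le ((hlow V₀ hV₀).trans hle)).ne'
  have hc := EReal.coe_toReal htop hbot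
  refine (hasLaplaceIntegral_of_forall (I := (upperLaplaceIntegral f a x).toReal) hx.1
    (fun ε hε => ?_) (fun ε hε => ?_)).integrable
  · obtain ⟨U, V, hU, hV, hlt⟩ := key ε hε
    have := (hlow V hV).trans hle
    rw [← hc, EReal.coe_le_coe_iff] at this
    exact ⟨U, hU, by linarith⟩
  · obtain ⟨U, V, hU, hV, hlt⟩ := key ε hε
    have := hup U hU
    rw [← hc, EReal.coe_le_coe_iff] at this
    exact ⟨V, hV, by linarith⟩

/-! ### Lebesgue integrable functions -/

/-- If `c < g x`, then `g > c` near `x` by semicontinuity, so the primitive has difference quotients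
at least `c` there. -/
theorem LowerSemicontinuous.le_lowerLaplaceDerivate_integral {g : ℝ → EReal} {a b : ℝ}
    (hg : LowerSemicontinuous g) (hbot : ∀ x, ⊥ < g x)
    (hint : IntegrableOn (fun x => (g x).toReal) (Icc a b))
    (htop : ∀ᵐ x ∂volume.restrict (Icc a b), g x < ⊤) {x : ℝ} (hx : x ∈ Icc a b) :
    g x ≤ lowerLaplaceDerivate a b (fun y => ∫ t in a..y, (g t).toReal) x := by
  have hcont : ContinuousOn (fun y => ∫ t in a..y, (g t).toReal) (Icc a b) := by
    rw [← uIcc_of_le (hx.1.trans hx.2)] at hint ⊢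
    exact intervalIntegral.continuousOn_primitive_interval hint
  refine EReal.ge_of_forall_gt_iff_ge.1 fun c hc => ?_
  obtain ⟨η, hη, hball⟩ := Metric.eventually_nhds_iff.1 (hg x c hc)
  refine le_lowerLaplaceDerivate hcont hx (half_pos hη) fun u hu v hv huv hxu hxv => ?_
  have hI : ∀ y ∈ Icc a b, ∀ z ∈ Icc a b,
      IntervalIntegrable (fun x => (g x).toReal) volume y z := fun y hy z hz =>
    (hint.mono_set (uIcc_subset_Icc hy hz)).intervalIntegrable
  have ha : a ∈ Icc a b := left_mem_Icc.2 (hx.1.trans hx.2)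
  rw [intervalIntegral.integral_interval_sub_left (hI a ha v hv) (hI a ha u hu)]
  have hconst : c * (v - u) = ∫ _ in u..v, c := by simp [mul_comm]
  rw [hconst]
  refine intervalIntegral.integral_mono_ae_restrict huv (by simp) (hI u hu v hv) ?_
  have htop' := ae_restrict_of_ae_restrict_of_subset (Icc_subset_Icc hu.1 hv.2) htop
  filter_upwards [htop', ae_restrict_mem measurableSet_Icc] with y hy hyuv
  have h1 : (c : EReal) < g y := hball (by
    rw [Real.dist_eq, abs_lt]
    constructor <;> linarith [hyuv.1, hyuv.2])
  rw [← EReal.coe_le_coe_iff, EReal.coe_toReal hy.ne (hbot y).ne']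
  exact h1.le

/-- By Vitali–Carathéodory some lower semicontinuous `g > f` has integral less than `ε` above that
of `f`; its primitive is the major function. -/
theorem exists_isLaplaceMajor_of_integrableOn {f : ℝ → ℝ} {a b ε : ℝ} (hab : a ≤ b)
    (hf : IntegrableOn f (Icc a b)) (hε : 0 < ε) :
    ∃ U, IsLaplaceMajor f a b U ∧ U b - U a ≤ (∫ t in a..b, f t) + ε := by
  obtain ⟨g, hfg, hlsc, hint, htop, hlt⟩ := exists_lt_lowerSemicontinuous_integral_lt f hf hε
  have hbot : ∀ x, ⊥ < g x := fun x => bot_le.trans_lt (hfg x)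
  have hd := fun x hx =>
    hlsc.le_lowerLaplaceDerivate_integral hbot hint htop (a := a) (b := b) (x := x) hx
  refine ⟨fun y => ∫ t in a..y, (g t).toReal, ⟨?_, fun x hx => ?_, fun x hx => ?_⟩, ?_⟩
  · rw [← uIcc_of_le hab] at hint ⊢
    exact intervalIntegral.continuousOn_primitive_interval hint
  · exact (hfg x).le.trans (hd x hx)
  · exact (hbot x).trans_le (hd x hx)
  · simp only [intervalIntegral.integral_same, sub_zero]
    rw [intervalIntegral.integral_of_le hab, intervalIntegral.integral_of_le hab,
      ← integral_Icc_eq_integral_Ioc, ← integral_Icc_eq_integral_Ioc]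
    exact hlt.le

/-- A Lebesgue integrable function is Laplace integrable, with the same integral. -/
theorem MeasureTheory.IntegrableOn.hasLaplaceIntegral {f : ℝ → ℝ} {a b : ℝ} (hab : a ≤ b)
    (hf : IntegrableOn f (Icc a b)) : HasLaplaceIntegral f a b (∫ t in a..b, f t) := by
  refine hasLaplaceIntegral_of_forall hab
    (fun ε hε => exists_isLaplaceMajor_of_integrableOn hab hf hε) (fun ε hε => ?_)
  have hf' : IntegrableOn (fun x => -f x) (Icc a b) := hf.neg
  obtain ⟨U, hU, hle⟩ := exists_isLaplaceMajor_of_integrableOn hab hf' hε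
  refine ⟨fun x => -U x, by simpa only [IsLaplaceMinor, neg_neg] using hU, ?_⟩
  rw [intervalIntegral.integral_neg] at hle
  linarith

/-- Major functions obey inequalities at every point, so null sets are not negligible by definition.
But `g - f` vanishes a.e., hence has Lebesgue and so Laplace integral zero. -/
theorem HasLaplaceIntegral.congr_ae {f g : ℝ → ℝ} {a b I : ℝ} (hab : a ≤ b)
    (hf : HasLaplaceIntegral f a b I) (hfg : f =ᵐ[volume.restrict (Icc a b)] g) :
    HasLaplaceIntegral g a b I := by
  have h0 : (fun x => g x - f x) =ᵐ[volume.restrict (Icc a b)] fun _ => (0 : ℝ) := by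
    filter_upwards [hfg] with x hx
    rw [hx, sub_self]
  have hint : IntegrableOn (fun x => g x - f x) (Icc a b) :=
    (integrable_congr h0).2 (integrable_zero _ _ _)
  have hval : ∫ t in a..b, (g t - f t) = 0 := by
    rw [intervalIntegral.integral_of_le hab, ← integral_Icc_eq_integral_Ioc,
      integral_congr_ae h0, integral_zero]
  simpa [hval] using hf.add hab (hint.hasLaplaceIntegral hab)

/-! ### Nonnegative Laplace integrable functions -/

theorem MonotoneOn.ae_hasDerivAt_deriv {F : ℝ → ℝ} {a b : ℝ} (hF : MonotoneOn F (Icc a b)) :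
    ∀ᵐ x ∂volume.restrict (Icc a b), x ∈ Ioo a b ∧ HasDerivAt F (deriv F x) x := by
  rw [← restrict_Ioo_eq_restrict_Icc, ae_restrict_iff' measurableSet_Ioo]
  filter_upwards [hF.ae_differentiableWithinAt_of_mem] with x hx hx'
  exact ⟨hx', ((hx (Ioo_subset_Icc_self hx')).differentiableAt
    (Icc_mem_nhds hx'.1 hx'.2)).hasDerivAt⟩

theorem MonotoneOn.integrableOn_deriv {F : ℝ → ℝ} {a b : ℝ} (hab : a ≤ b)
    (hF : MonotoneOn F (Icc a b)) : IntegrableOn (deriv F) (Icc a b) := by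
  rw [← uIcc_of_le hab] at hF
  rw [integrableOn_Icc_iff_integrableOn_Ioc]
  exact (intervalIntegrable_iff_integrableOn_Ioc_of_le hab).1 hF.intervalIntegrable_deriv

theorem MonotoneOn.ae_deriv_nonneg {F : ℝ → ℝ} {a b : ℝ} (hF : MonotoneOn F (Icc a b)) :
    ∀ᵐ x ∂volume.restrict (Icc a b), 0 ≤ deriv F x := by
  filter_upwards [hF.ae_hasDerivAt_deriv] with x hx
  rw [← hx.2.differentiableAt.derivWithin (uniqueDiffOn_Icc (hx.1.1.trans hx.1.2) x
    (Ioo_subset_Icc_self hx.1))]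
  exact hF.derivWithin_nonneg

/-- Only an inequality, since a monotone function may have a singular part. -/
theorem MonotoneOn.lintegral_deriv_le {F : ℝ → ℝ} {a b : ℝ} (hab : a ≤ b)
    (hF : MonotoneOn F (Icc a b)) :
    ∫⁻ x in Icc a b, ENNReal.ofReal (deriv F x) ≤ ENNReal.ofReal (F b - F a) := by
  rw [← ofReal_integral_eq_lintegral_ofReal (hF.integrableOn_deriv hab) hF.ae_deriv_nonneg]
  refine ENNReal.ofReal_le_ofReal ?_
  have h := MonotoneOn.intervalIntegral_deriv_mem_uIcc (f := F) (a := a) (b := b)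
    (by rwa [uIcc_of_le hab])
  rw [uIcc_of_le (sub_nonneg.2 (hF (left_mem_Icc.2 hab) (right_mem_Icc.2 hab) hab)),
    intervalIntegral.integral_of_le hab, ← integral_Icc_eq_integral_Ioc] at h
  exact h.2

theorem IsLaplaceMajor.ae_le_deriv {f U : ℝ → ℝ} {a b : ℝ} (hU : IsLaplaceMajor f a b U)
    (hmono : MonotoneOn U (Icc a b)) :
    ∀ᵐ x ∂volume.restrict (Icc a b), f x ≤ deriv U x := by
  filter_upwards [hmono.ae_hasDerivAt_deriv] with x hx
  exact EReal.coe_le_coe_iff.1 ((hU.le_derivate x (Ioo_subset_Icc_self hx.1)).trans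
    (lowerLaplaceDerivate_le_of_hasDerivAt hU.continuousOn hx.1 hx.2))

/-- The derivative of a monotone major function `U` is close to `f`, up to the derivative of
the monotone function `U - V`. -/
theorem IsLaplaceMajor.ae_deriv_sub_le {f U V : ℝ → ℝ} {a b : ℝ} (hU : IsLaplaceMajor f a b U)
    (hV : IsLaplaceMinor f a b V) (hmono : MonotoneOn U (Icc a b)) :
    ∀ᵐ x ∂volume.restrict (Icc a b), deriv U x - f x ≤ deriv (fun y => U y - V y) x := by
  filter_upwards [hmono.ae_hasDerivAt_deriv, (hU.monotoneOn_sub hV).ae_hasDerivAt_deriv]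
    with x hx hx'
  -- `V` need not be monotone, but `-V = (U - V) - U` is a difference of monotone functions.
  have hd : HasDerivAt (fun y => -V y) (deriv (fun y => U y - V y) x - deriv U x) x := by
    refine (hx'.2.sub hx.2).congr_of_eventuallyEq (Eventually.of_forall fun y => ?_)
    simp
  have h1 := (IsLaplaceMajor.le_derivate hV x (Ioo_subset_Icc_self hx.1)).trans
    (lowerLaplaceDerivate_le_of_hasDerivAt (IsLaplaceMajor.continuousOn hV) hx.1 hd)
  linarith [EReal.coe_le_coe_iff.1 h1]

/-- Take `U n`, `V n` with `U n - V n` increasing by less than `2⁻ⁿ`. The derivatives of these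
monotone differences have summable integrals, so they tend to `0` a.e.; as they bound `deriv (U n) -
f ≥ 0`, also `deriv (U n) → f` a.e. -/
theorem HasLaplaceIntegral.integrableOn_of_nonneg {f : ℝ → ℝ} {a b I : ℝ} (hab : a ≤ b)
    (hf : HasLaplaceIntegral f a b I) (h0 : ∀ x ∈ Icc a b, 0 ≤ f x) :
    IntegrableOn f (Icc a b) := by
  have hpos : ∀ n : ℕ, (0 : ℝ) < (1 / 2) ^ n / 2 := fun n => by positivity
  choose U hU hU' using fun n => hf.exists_major (hpos n)
  choose V hV hV' using fun n => hf.exists_minor (hpos n)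
  have hUm := fun n => (hU n).monotoneOn h0
  have hRm := fun n => (hU n).monotoneOn_sub (hV n)
  have hsum : ∑' n, ∫⁻ x in Icc a b, ENNReal.ofReal (deriv (fun y => U n y - V n y) x) ≠ ⊤ := by
    refine ne_top_of_le_ne_top (b := ∑' n : ℕ, ENNReal.ofReal ((1 / 2) ^ n)) ?_
      (ENNReal.tsum_le_tsum fun n => ((hRm n).lintegral_deriv_le hab).trans
        (ENNReal.ofReal_le_ofReal (by linarith [hU' n, hV' n])))
    rw [← ENNReal.ofReal_tsum_of_nonneg (fun n => by positivity)
      (summable_geometric_of_lt_one (by norm_num) (by norm_num))]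
    exact ENNReal.ofReal_ne_top
  have hmeas : ∀ n, AEMeasurable (fun x => ENNReal.ofReal (deriv (fun y => U n y - V n y) x))
      (volume.restrict (Icc a b)) := fun n => (measurable_deriv _).ennreal_ofReal.aemeasurable
  rw [← lintegral_tsum hmeas] at hsum
  have hlim : ∀ᵐ x ∂volume.restrict (Icc a b),
      Tendsto (fun n => deriv (U n) x) atTop (𝓝 (f x)) := by
    filter_upwards [ae_lt_top' (AEMeasurable.tsum hmeas) hsum,
      ae_all_iff.2 fun n => (hU n).ae_le_deriv (hUm n),
      ae_all_iff.2 fun n => (hU n).ae_deriv_sub_le (hV n) (hUm n)] with x h1 h2 h3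
    have h4 := ENNReal.tendsto_atTop_zero_of_tsum_ne_top h1.ne
    have h5 : Tendsto (fun n => deriv (fun y => U n y - V n y) x) atTop (𝓝 0) := by
      have := (ENNReal.tendsto_toReal ENNReal.zero_ne_top).comp h4
      refine this.congr fun n => ENNReal.toReal_ofReal ?_
      linarith [h2 n, h3 n]
    have h6 := squeeze_zero (fun n => sub_nonneg.2 (h2 n)) h3 h5
    simpa using h6.add_const (f x)
  -- The a.e. limit gives measurability of `f`, and `0 ≤ f ≤ deriv (U 0)` gives integrability.
  refine ((hUm 0).integrableOn_deriv hab).mono' (aestronglyMeasurable_of_tendsto_ae atTop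
    (fun n => (measurable_deriv (U n)).aestronglyMeasurable) hlim) ?_
  filter_upwards [(hU 0).ae_le_deriv (hUm 0), ae_restrict_mem measurableSet_Icc] with x hx hx'
  rwa [Real.norm_of_nonneg (h0 x hx')]

/-- A Laplace integrable function that is nonnegative almost everywhere is Lebesgue integrable. -/
theorem LaplaceIntegrable.integrableOn_of_ae_nonneg {f : ℝ → ℝ} {a b : ℝ} (hab : a ≤ b)
    (hf : LaplaceIntegrable f a b) (h0 : ∀ᵐ x ∂volume.restrict (Icc a b), 0 ≤ f x) :
    IntegrableOn f (Icc a b) := by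
  have hae : f =ᵐ[volume.restrict (Icc a b)] fun x => max (f x) 0 := by
    filter_upwards [h0] with x hx using (max_eq_left hx).symm
  exact (integrable_congr hae).2
    ((hf.hasIntegral.congr_ae hab hae).integrableOn_of_nonneg hab fun x _ => le_max_right _ _)

/-! ### Equiabsolute continuity and uniform integrability -/

/-- An equidistant grid cut off at `b`; later cells degenerate to `{b}`, which keeps `p` monotone on
all of `ℕ`. -/
theorem exists_fine_partition {a b r : ℝ} (hab : a ≤ b) (hr : 0 < r) :
    ∃ (N : ℕ) (p : ℕ → ℝ), Monotone p ∧ (∀ i, p i ∈ Icc a b) ∧ (∀ i, p (i + 1) - p i ≤ r) ∧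
      ∀ x ∈ Icc a b, ∃ i : Fin N, x ∈ Icc (p i) (p (i + 1)) := by
  refine ⟨⌊(b - a) / r⌋₊ + 1, fun i => min b (a + i * r), fun i j hij => ?_,
    fun i => ⟨?_, min_le_left _ _⟩, fun i => ?_, fun x hx => ?_⟩
  · exact min_le_min le_rfl (by gcongr)
  · exact le_min hab (by have := mul_nonneg (Nat.cast_nonneg (α := ℝ) i) hr.le; linarith)
  · push_cast
    have : min b (a + (i + 1) * r) ≤ min b (a + i * r) + r := by
      rw [← min_add_add_right]
      exact min_le_min (by linarith) (by linarith)
    linarith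
  · have h0 : 0 ≤ (x - a) / r := div_nonneg (sub_nonneg.2 hx.1) hr.le
    refine ⟨⟨⌊(x - a) / r⌋₊, Nat.lt_succ_of_le (Nat.floor_le_floor ?_)⟩, ?_, ?_⟩
    · gcongr
      exact hx.2
    · have := Nat.floor_le h0
      rw [le_div_iff₀ hr] at this
      exact (min_le_right _ _).trans (by linarith)
    · have := Nat.lt_floor_add_one ((x - a) / r)
      rw [div_lt_iff₀ hr] at this
      refine le_min hx.2 ?_
      push_cast
      linarith

theorem EquiAbsolutelyContinuousOn.congr {F G : ℕ → ℝ → ℝ} {a b : ℝ}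
    (hF : EquiAbsolutelyContinuousOn F a b) (h : ∀ n, ∀ x ∈ Icc a b, F n x = G n x) :
    EquiAbsolutelyContinuousOn G a b := by
  intro ε hε
  obtain ⟨δ, hδ, H⟩ := hF ε hε
  refine ⟨δ, hδ, fun n k u v huv hd hs => lt_of_eq_of_lt ?_ (H n k u v huv hd hs)⟩
  refine Finset.sum_congr rfl fun i _ => ?_
  obtain ⟨h1, h2, h3⟩ := huv i
  rw [h n _ ⟨h1, h2.trans h3⟩, h n _ ⟨h1.trans h2, h3⟩]

theorem eLpNorm_indicator_restrict_eq {f : ℝ → ℝ} {s t : Set ℝ} (hs : MeasurableSet s) :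
    eLpNorm (s.indicator f) 1 (volume.restrict t) = ∫⁻ x in s ∩ t, ‖f x‖ₑ := by
  rw [eLpNorm_one_eq_lintegral_enorm, ← Measure.restrict_restrict hs, ← lintegral_indicator hs]
  simp only [enorm_indicator_eq_indicator_enorm]

theorem volume_iUnion_Ioo_eq {k : ℕ} {u v : Fin k → ℝ} (huv : ∀ i, u i ≤ v i)
    (hd : ∀ i j, i ≠ j → Disjoint (Ioo (u i) (v i)) (Ioo (u j) (v j))) :
    volume (⋃ i, Ioo (u i) (v i)) = ENNReal.ofReal (∑ i, (v i - u i)) := by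
  rw [measure_iUnion (fun i j hij => hd i j hij) fun _ => measurableSet_Ioo, tsum_fintype,
    ENNReal.ofReal_sum_of_nonneg fun i _ => sub_nonneg.2 (huv i)]
  simp

/-- The indefinite integrals of a uniformly integrable sequence are equiabsolutely continuous. -/
theorem MeasureTheory.UnifIntegrable.equiAbsolutelyContinuousOn {u : ℕ → ℝ → ℝ} {a b : ℝ}
    (hu : ∀ n, IntegrableOn (u n) (Icc a b))
    (hui : UnifIntegrable u 1 (volume.restrict (Icc a b))) :
    EquiAbsolutelyContinuousOn (fun n x => ∫ t in a..x, u n t) a b := by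
  intro ε hε
  -- Uniform integrability yields `≤`, so `ε / 2` secures the strict inequality.
  obtain ⟨δ, hδ, H⟩ := hui (half_pos hε)
  refine ⟨δ, hδ, fun n k c d hcd hdisj hs => ?_⟩
  have hvol := volume_iUnion_Ioo_eq (fun i => (hcd i).2.1) hdisj
  have hmeas : MeasurableSet (⋃ i, Ioo (c i) (d i)) := MeasurableSet.iUnion fun _ =>
    measurableSet_Ioo
  have h1 := H n (⋃ i, Ioo (c i) (d i)) hmeas ((Measure.restrict_apply_le _ _).trans
    (hvol.le.trans (ENNReal.ofReal_le_ofReal hs.le)))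
  have hsub : (⋃ i, Ioo (c i) (d i)) ⊆ Icc a b := iUnion_subset fun i =>
    Ioo_subset_Icc_self.trans (Icc_subset_Icc (hcd i).1 (hcd i).2.2)
  rw [eLpNorm_indicator_restrict_eq hmeas, inter_eq_left.2 hsub,
    lintegral_iUnion (fun _ => measurableSet_Ioo) (fun i j hij => hdisj i j hij),
    tsum_fintype] at h1
  have h2 : ENNReal.ofReal (∑ i, |(∫ t in a..d i, u n t) - ∫ t in a..c i, u n t|)
      ≤ ENNReal.ofReal (ε / 2) := by
    rw [ENNReal.ofReal_sum_of_nonneg fun i _ => abs_nonneg _]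
    refine (Finset.sum_le_sum fun i _ => ?_).trans h1
    obtain ⟨h3, h4, h5⟩ := hcd i
    have hI : ∀ y ∈ Icc a b, IntervalIntegrable (u n) volume a y := fun y hy =>
      ((hu n).mono_set (uIcc_subset_Icc (left_mem_Icc.2 (hy.1.trans hy.2)) hy)).intervalIntegrable
    rw [intervalIntegral.integral_interval_sub_left (hI _ ⟨h3.trans h4, h5⟩)
      (hI _ ⟨h3, h4.trans h5⟩), ← Real.enorm_eq_ofReal_abs,
      intervalIntegral.integral_of_le h4, integral_Ioc_eq_integral_Ioo]
    exact enorm_integral_le_lintegral_enorm _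
  have := (ENNReal.ofReal_le_ofReal_iff (half_pos hε).le).1 h2
  linarith

/-- If the indefinite integrals of nonnegative functions are equiabsolutely continuous, then the
functions are uniformly integrable. -/
theorem EquiAbsolutelyContinuousOn.unifIntegrable {u : ℕ → ℝ → ℝ} {a b : ℝ} (hab : a ≤ b)
    (hu : ∀ n, IntegrableOn (u n) (Icc a b))
    (h0 : ∀ n, ∀ᵐ x ∂volume.restrict (Icc a b), 0 ≤ u n x)
    (hF : EquiAbsolutelyContinuousOn (fun n x => ∫ t in a..x, u n t) a b) :
    UnifIntegrable u 1 (volume.restrict (Icc a b)) := by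
  intro ε hε
  obtain ⟨δ, hδ, H⟩ := hF ε hε
  -- Halving `δ` leaves room for an open set of measure less than `δ` around a compact part of `s`.
  refine ⟨δ / 2, half_pos hδ, fun n s hs hvol => ?_⟩
  rw [eLpNorm_indicator_restrict_eq hs]
  rw [Measure.restrict_apply hs] at hvol
  have hs' : MeasurableSet (s ∩ Icc a b) := hs.inter measurableSet_Icc
  set ν : Measure ℝ := (volume.restrict (Icc a b)).withDensity fun x => ‖u n x‖ₑ with hν
  have hfin : IsFiniteMeasure ν := isFiniteMeasure_withDensity (hu n).2.ne
  have hνs : ∀ t ⊆ Icc a b, MeasurableSet t → ν t = ∫⁻ x in t, ‖u n x‖ₑ := fun t ht htm => by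
    rw [hν, withDensity_apply _ htm, Measure.restrict_restrict htm, inter_eq_left.2 ht]
  rw [← hνs _ inter_subset_right hs']
  by_contra! hlt
  -- By inner regularity of the finite measure `ν` it suffices to bound `ν K` for compact `K`.
  obtain ⟨K, hKs, hK, hltK⟩ := hs'.exists_lt_isCompact_of_ne_top (measure_ne_top ν _) hlt
  refine hltK.not_ge ?_
  obtain ⟨O, hKO, hO, hOvol⟩ := K.exists_isOpen_lt_of_lt (μ := volume) (ENNReal.ofReal δ)
    ((measure_mono hKs).trans_lt (hvol.trans_lt
      ((ENNReal.ofReal_lt_ofReal_iff hδ).2 (half_lt_self hδ))))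
  obtain ⟨r, hr, hrO⟩ := hK.exists_thickening_subset_open hO hKO
  obtain ⟨N, p, hp, hpab, hpr, hpc⟩ := exists_fine_partition hab (half_pos hr)
  classical
  -- Cells that miss `K` collapse to a point. Those that meet `K` are shorter than `r`, so they lie
  -- in `O` and their total length is less than `δ`.
  let d : Fin N → ℝ := fun i => if (K ∩ Icc (p i) (p (i + 1))).Nonempty then p (i + 1) else p i
  have hd : ∀ i : Fin N, p i ≤ d i ∧ d i ≤ p (i + 1) := fun i => by
    have := hp (Nat.le_succ (i : ℕ))
    by_cases h : (K ∩ Icc (p i) (p (i + 1))).Nonempty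
    · simpa [d, h] using this
    · simpa [d, h] using this
  have hdisj : ∀ i j : Fin N, i ≠ j → Disjoint (Ioo (p i) (d i)) (Ioo (p j) (d j)) := by
    intro i j hij
    have := hp.pairwise_disjoint_on_Ioo_succ (fun h => hij (Fin.ext h) : (i : ℕ) ≠ j)
    exact this.mono (Ioo_subset_Ioo_right (hd i).2) (Ioo_subset_Ioo_right (hd j).2)
  have hsubO : (⋃ i : Fin N, Ioo (p i) (d i)) ⊆ O := by
    refine iUnion_subset fun i x hx => hrO ?_
    by_cases h : (K ∩ Icc (p i) (p (i + 1))).Nonempty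
    · obtain ⟨y, hyK, hy⟩ := h
      have hx2 := hx.2.le.trans (hd i).2
      refine Metric.mem_thickening_iff.2 ⟨y, hyK, ?_⟩
      rw [Real.dist_eq, abs_lt]
      have := hpr i
      constructor <;> linarith [hx.1, hy.1, hy.2]
    · simp [d, h] at hx
  have hlen : ∑ i, (d i - p i) < δ := by
    have := (volume_iUnion_Ioo_eq (fun i => (hd i).1) hdisj).ge.trans_lt
      ((measure_mono hsubO).trans_lt hOvol)
    exact (ENNReal.ofReal_lt_ofReal_iff hδ).1 this
  have hsum := H n N (fun i => p i) d
    (fun i => ⟨(hpab i).1, (hd i).1, (hd i).2.trans (hpab (i + 1)).2⟩) hdisj hlen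
  have hcover : K ⊆ ⋃ i : Fin N, Icc (p i) (d i) := by
    intro x hx
    obtain ⟨i, hi⟩ := hpc x (hKs hx).2
    have hne : (K ∩ Icc (p i) (p (i + 1))).Nonempty := ⟨x, hx, hi⟩
    exact mem_iUnion.2 ⟨i, by simpa [d, hne] using hi⟩
  refine (measure_mono hcover).trans ((measure_iUnion_fintype_le _ _).trans ?_)
  refine le_trans (le_of_eq ?_) (ENNReal.ofReal_le_ofReal hsum.le)
  rw [ENNReal.ofReal_sum_of_nonneg fun i _ => abs_nonneg _]
  refine Finset.sum_congr rfl fun i _ => ?_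
  have hpi := hpab i
  have hdi : d i ∈ Icc a b := ⟨hpi.1.trans (hd i).1, (hd i).2.trans (hpab (i + 1)).2⟩
  have hsub := Icc_subset_Icc hpi.1 hdi.2
  have hI : ∀ y ∈ Icc a b, IntervalIntegrable (u n) volume a y := fun y hy =>
    ((hu n).mono_set (uIcc_subset_Icc (left_mem_Icc.2 hab) hy)).intervalIntegrable
  -- Nonnegativity is essential here: the increment of the primitive over a cell is then the full
  -- `ν`-mass of the cell.
  have h0' := ae_restrict_of_ae_restrict_of_subset hsub (h0 n)
  rw [hνs _ hsub measurableSet_Icc, intervalIntegral.integral_interval_sub_left (hI _ hdi)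
    (hI _ hpi), intervalIntegral.integral_of_le (hd i).1, ← integral_Icc_eq_integral_Ioc,
    abs_of_nonneg (integral_nonneg_of_ae h0'),
    ofReal_integral_eq_lintegral_ofReal ((hu n).mono_set hsub) h0']
  refine lintegral_congr_ae ?_
  filter_upwards [h0'] with x hx using Real.enorm_of_nonneg hx

/-- `UnifIntegrable` contains no L¹ bound. On a bounded interval one follows: `N` cells of length at
most `δ` carry mass at most `1` each. -/
theorem MeasureTheory.UnifIntegrable.uniformIntegrable_Icc {u : ℕ → ℝ → ℝ} {a b : ℝ}
    (hab : a ≤ b) (hu : ∀ n, IntegrableOn (u n) (Icc a b))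
    (hui : UnifIntegrable u 1 (volume.restrict (Icc a b))) :
    UniformIntegrable u 1 (volume.restrict (Icc a b)) := by
  obtain ⟨δ, hδ, H⟩ := hui one_pos
  obtain ⟨N, p, -, hpab, hpr, hpc⟩ := exists_fine_partition hab hδ
  refine ⟨fun n => (hu n).1, hui, N, fun n => ?_⟩
  rw [eLpNorm_one_eq_lintegral_enorm]
  have hcover : Icc a b ⊆ ⋃ i : Fin N, Icc (p i) (p (i + 1)) := fun x hx => mem_iUnion.2 (hpc x hx)
  refine (lintegral_mono_set hcover).trans ((lintegral_iUnion_le _ _).trans ?_)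
  rw [tsum_fintype]
  refine (Finset.sum_le_card_nsmul _ _ 1 fun i _ => ?_).trans (by simp)
  have := H n (Icc (p i) (p (i + 1))) measurableSet_Icc ((Measure.restrict_apply_le _ _).trans
    (by rw [Real.volume_Icc]; exact ENNReal.ofReal_le_ofReal (hpr i)))
  rwa [eLpNorm_indicator_restrict_eq measurableSet_Icc,
    inter_eq_left.2 (Icc_subset_Icc (hpab i).1 (hpab (i + 1)).2), ENNReal.ofReal_one] at this

/-- **Scheffé's lemma** for nonnegative functions. -/
theorem tendsto_eLpNorm_sub_of_tendsto_integral {α : Type*} [MeasurableSpace α] {μ : Measure α}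
    {u : ℕ → α → ℝ} {w : α → ℝ} (hu : ∀ n, Integrable (u n) μ) (hw : Integrable w μ)
    (h0 : ∀ n, ∀ᵐ x ∂μ, 0 ≤ u n x) (hlim : ∀ᵐ x ∂μ, Tendsto (fun n => u n x) atTop (𝓝 (w x)))
    (hint : Tendsto (fun n => ∫ x, u n x ∂μ) atTop (𝓝 (∫ x, w x ∂μ))) :
    Tendsto (fun n => eLpNorm (u n - w) 1 μ) atTop (𝓝 0) := by
  -- As `u n ≥ 0`, the part `(w - u n)⁺` is dominated by `|w|`.
  have hpos : Tendsto (fun n => ∫ x, max (w x - u n x) 0 ∂μ) atTop (𝓝 0) := by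
    have := tendsto_integral_of_dominated_convergence (μ := μ)
      (F := fun n x => max (w x - u n x) 0) (f := fun _ => (0 : ℝ)) (fun x => |w x|)
      (fun n => (hw.sub (hu n)).pos_part.1) hw.abs (fun n => ?_) ?_
    · simpa using this
    · filter_upwards [h0 n] with x hx
      rw [Real.norm_of_nonneg (le_max_right _ _)]
      exact max_le (by linarith [le_abs_self (w x)]) (abs_nonneg _)
    · filter_upwards [hlim] with x hx
      simpa using (hx.const_sub (w x)).max (tendsto_const_nhds (x := (0 : ℝ)))
  have hnorm : Tendsto (fun n => ∫ x, ‖(u n - w) x‖ ∂μ) atTop (𝓝 0) := by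
    -- Uses `|u n - w| = (u n - w) + 2 (w - u n)⁺`.
    have h1 := (hint.sub_const (∫ x, w x ∂μ)).add (hpos.const_mul 2)
    simp only [sub_self, mul_zero, add_zero] at h1
    refine h1.congr fun n => ?_
    have h2 : Integrable (fun x => max (w x - u n x) 0) μ := (hw.sub (hu n)).pos_part
    have h3 : Integrable (fun x => u n x - w x) μ := (hu n).sub hw
    rw [← integral_sub (hu n) hw, ← integral_const_mul,
      ← integral_add h3 (h2.const_mul 2)]
    refine integral_congr_ae (Eventually.of_forall fun x => ?_)
    simp only [Pi.sub_apply, Real.norm_eq_abs]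
    rcases le_total (w x) (u n x) with h | h
    · rw [max_eq_right (by linarith), abs_of_nonneg (by linarith)]
      ring
    · rw [max_eq_left (by linarith), abs_of_nonpos (by linarith)]
      ring
  have h4 := ENNReal.tendsto_ofReal hnorm
  rw [ENNReal.ofReal_zero] at h4
  refine h4.congr fun n => ?_
  rw [ofReal_integral_norm_eq_lintegral_enorm ((hu n).sub hw), eLpNorm_one_eq_lintegral_enorm]

/-! ### Convergence theorems -/

/-- The Laplace integrals of `f n` converge to that of `f` if those of `f n - g` are Lebesgue
integrals that converge to that of `f - g`. -/
theorem laplace_convergence_of_sub {f g : ℝ → ℝ} {fn : ℕ → ℝ → ℝ} {a b : ℝ} (hab : a ≤ b)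
    (hg : LaplaceIntegrable g a b) (hu : ∀ n, IntegrableOn (fun y => fn n y - g y) (Icc a b))
    (hw : IntegrableOn (fun y => f y - g y) (Icc a b))
    (hlim : ∀ x ∈ Icc a b, Tendsto (fun n => ∫ y in a..x, (fn n y - g y)) atTop
      (𝓝 (∫ y in a..x, (f y - g y)))) :
    LaplaceIntegrable f a b ∧ ∀ x ∈ Icc a b,
      Tendsto (fun n => laplaceIntegral (fn n) a x) atTop (𝓝 (laplaceIntegral f a x)) := by
  -- Writes `v = (v - g) + g`, a Lebesgue part plus the fixed function `g`.
  have key : ∀ v : ℝ → ℝ, IntegrableOn (fun y => v y - g y) (Icc a b) → ∀ x ∈ Icc a b,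
      HasLaplaceIntegral v a x ((∫ y in a..x, (v y - g y)) + laplaceIntegral g a x) := by
    intro v hv x hx
    have := ((hv.mono_set (Icc_subset_Icc_right hx.2)).hasLaplaceIntegral hx.1).add hx.1
      (hg.restrict hx).hasIntegral
    simpa only [sub_add_cancel] using this
  refine ⟨(key f hw b (right_mem_Icc.2 hab)).integrable, fun x hx => ?_⟩
  simp only [(key f hw x hx).integral_eq, fun n => (key (fn n) (hu n) x hx).integral_eq]
  exact (hlim x hx).add_const _

theorem mainTheorem6 (a b : ℝ) (hab : a < b) (f g : ℝ → ℝ) (fn : ℕ → ℝ → ℝ)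
    (hfn : ∀ n, LaplaceIntegrable (fn n) a b)
    (hg : LaplaceIntegrable g a b)
    (hge : ∀ n, ∀ᵐ x ∂volume.restrict (Icc a b), g x ≤ fn n x)
    (hlim : ∀ᵐ x ∂volume.restrict (Icc a b), Tendsto (fun n => fn n x) atTop (𝓝 (f x))) :
    -- all the integrals below exist
    (∀ u : ℝ → ℝ, LaplaceIntegrable u a b → ∀ x ∈ Icc a b, LaplaceIntegrable u a x) ∧
    (∀ n, LaplaceIntegrable (fun y => fn n y - g y) a b) ∧
    -- the convergence theorem
    ((LaplaceIntegrable f a b ∧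
        ∀ x ∈ Icc a b,
          Tendsto (fun n => laplaceIntegral (fn n) a x) atTop (𝓝 (laplaceIntegral f a x))) ↔
      EquiAbsolutelyContinuousOn
        (fun n x => laplaceIntegral (fun y => fn n y - g y) a x) a b) ∧
    -- the dominated convergence theorem
    (∀ h : ℝ → ℝ, LaplaceIntegrable h a b →
      (∀ n, ∀ᵐ x ∂volume.restrict (Icc a b), fn n x ≤ h x) →
      LaplaceIntegrable f a b ∧
        ∀ x ∈ Icc a b,
          Tendsto (fun n => laplaceIntegral (fn n) a x) atTop (𝓝 (laplaceIntegral f a x))) := by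
  have hsub : ∀ v : ℝ → ℝ, LaplaceIntegrable v a b → LaplaceIntegrable (fun y => v y - g y) a b :=
    fun v hv => (hv.hasIntegral.sub hab.le hg.hasIntegral).integrable
  have h0 : ∀ n, ∀ᵐ x ∂volume.restrict (Icc a b), 0 ≤ fn n x - g x := fun n => by
    filter_upwards [hge n] with x hx using sub_nonneg.2 hx
  have hu : ∀ n, IntegrableOn (fun y => fn n y - g y) (Icc a b) := fun n =>
    (hsub _ (hfn n)).integrableOn_of_ae_nonneg hab.le (h0 n)
  have hulim : ∀ᵐ x ∂volume.restrict (Icc a b),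
      Tendsto (fun n => fn n x - g x) atTop (𝓝 (f x - g x)) := by
    filter_upwards [hlim] with x hx using hx.sub_const _
  have hw0 : ∀ᵐ x ∂volume.restrict (Icc a b), 0 ≤ f x - g x := by
    filter_upwards [hulim, ae_all_iff.2 h0] with x hx hx0
    exact ge_of_tendsto' hx hx0
  have hF : ∀ n, ∀ x ∈ Icc a b,
      laplaceIntegral (fun y => fn n y - g y) a x = ∫ y in a..x, (fn n y - g y) := fun n x hx =>
    (((hu n).mono_set (Icc_subset_Icc_right hx.2)).hasLaplaceIntegral hx.1).integral_eq
  have hset : ∀ v : ℝ → ℝ, ∀ x ∈ Icc a b,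
      ∫ y in a..x, v y = ∫ y in Ioc a x, v y ∂volume.restrict (Icc a b) := fun v x hx => by
    rw [intervalIntegral.integral_of_le hx.1, Measure.restrict_restrict measurableSet_Ioc,
      inter_eq_left.2 (Ioc_subset_Icc_self.trans (Icc_subset_Icc_right hx.2))]
  refine ⟨fun u hu x hx => hu.restrict hx, fun n => hsub _ (hfn n), ⟨fun h => ?_, fun h => ?_⟩,
    fun h hh hle => ?_⟩
  · have hw : IntegrableOn (fun y => f y - g y) (Icc a b) :=
      (hsub f h.1).integrableOn_of_ae_nonneg hab.le hw0
    have hb := right_mem_Icc.2 hab.le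
    have hIoc : ∀ v : ℝ → ℝ, ∫ x in a..b, v x = ∫ x in Icc a b, v x := fun v => by
      rw [intervalIntegral.integral_of_le hab.le, integral_Icc_eq_integral_Ioc]
    have hint : Tendsto (fun n => ∫ x in Icc a b, (fn n x - g x)) atTop
        (𝓝 (∫ x in Icc a b, (f x - g x))) := by
      -- Convergence at the single point `x = b` already suffices for Scheffé's lemma.
      have h1 := (h.2 b hb).sub_const (laplaceIntegral g a b)
      rw [← (h.1.hasIntegral.sub hab.le hg.hasIntegral).integral_eq,
        (hw.hasLaplaceIntegral hab.le).integral_eq, hIoc] at h1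
      refine h1.congr fun n => ?_
      rw [← ((hfn n).hasIntegral.sub hab.le hg.hasIntegral).integral_eq, hF n b hb, hIoc]
    have hL1 := tendsto_eLpNorm_sub_of_tendsto_integral hu hw h0 hulim hint
    have hui := unifIntegrable_of_tendsto_Lp le_rfl ENNReal.one_ne_top
      (fun n => memLp_one_iff_integrable.2 (hu n)) (memLp_one_iff_integrable.2 hw) hL1
    exact (hui.equiAbsolutelyContinuousOn hu).congr fun n x hx => (hF n x hx).symm
  · have hui := (h.congr hF).unifIntegrable hab.le hu h0
    -- The uniform L¹ bound passes to the a.e. limit, so `f - g` is integrable before Vitali's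
    -- theorem is applied.
    have hw : IntegrableOn (fun y => f y - g y) (Icc a b) :=
      (hui.uniformIntegrable_Icc hab.le hu).integrable_of_ae_tendsto hulim
    have hL1 := tendsto_Lp_finite_of_tendsto_ae le_rfl ENNReal.one_ne_top (fun n => (hu n).1)
      (memLp_one_iff_integrable.2 hw) hui hulim
    refine laplace_convergence_of_sub hab.le hg hu hw fun x hx => ?_
    simp only [hset _ x hx]
    exact tendsto_setIntegral_of_L1' _ hw.1 (Eventually.of_forall hu) hL1 _
  · have hk : IntegrableOn (fun y => h y - g y) (Icc a b) := by
      refine (hsub h hh).integrableOn_of_ae_nonneg hab.le ?_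
      -- `h - g ≥ f_0 - g ≥ 0` a.e., so `h - g` is Lebesgue integrable as well.
      filter_upwards [h0 0, hle 0] with x h1 h2 using h1.trans (sub_le_sub_right h2 _)
    have hbound : ∀ n, ∀ᵐ x ∂volume.restrict (Icc a b), ‖fn n x - g x‖ ≤ h x - g x := fun n => by
      filter_upwards [h0 n, hle n] with x h1 h2
      rw [Real.norm_of_nonneg h1]
      exact sub_le_sub_right h2 _
    have hw : IntegrableOn (fun y => f y - g y) (Icc a b) := by
      refine hk.mono' (aestronglyMeasurable_of_tendsto_ae atTop (fun n => (hu n).1) hulim) ?_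
      filter_upwards [hulim, ae_all_iff.2 hbound] with x hx hxb
      exact le_of_tendsto' hx.norm hxb
    refine laplace_convergence_of_sub hab.le hg hu hw fun x hx => ?_
    simp only [hset _ x hx]
    exact tendsto_integral_of_dominated_convergence (fun y => h y - g y)
      (fun n => (hu n).1.restrict) (Integrable.restrict hk) (fun n => ae_restrict_of_ae (hbound n))
      (ae_restrict_of_ae hulim)
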